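/- Let $n\ge 2$ and let $C_{2n}$ be the cycle graph with vertex set $\mathbb Z/2n\mathbb Z$ and edges $\{i,i+1\}$. For a set $R$ of ordered pairs of distinct vertices put $\operatorname{DE}(R)=\operatorname{conv}\{\boldsymbol e_v-\boldsymbol e_w : (v,w)\in R\}\subset\mathbb R^{\mathbb Z/2n\mathbb Z}$. Let $Q^+=\{(i,i+1): i\in\mathbb Z/2n\mathbb Z\}$, $Q^-=\{(i+1,i): i\in\mathbb Z/2n\mathbb Z\}$, $Q=Q^+\cup Q^-$, and let $\operatorname{SE}(C_{2n})=\operatorname{DE}(Q)$ be the symmetric edge polytope of $C_{2n}$. For a set $E$ of ordered pairs write $-E=\{(w,v):(v,w)\in E\}$. Let $f_d$ be the number of (nonempty) faces of $\operatorname{SE}(C_{2n})$ of dimension $d$. 1. $\dim\operatorname{SE}(C_{2n})=2n-1$. 2. For $R\subseteq Q$, $\operatorname{DE}(R)$ is a facet of $\operatorname{SE}(C_{2n})$ if and only if $|R\cap Q^+|=|R\cap Q^-|=n$ and $(R\cap Q^+)\cap(-(R\cap Q^-))=\emptyset$. The map $E\mapsto \operatorname{DE}\bigl(E\cup -(Q^+\setminus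 E)\bigr)$ is a bijection from the set of $n$-element subsets of $Q^+$ to the set of facets of $\operatorname{SE}(C_{2n})$, and hence $f_{2n-2}=\binom{2n}{n}$. 3. Let $0\le d<2n-2$. Every face of dimension $d$ of $\operatorname{SE}(C_{2n})$ is a $d$-simplex. For $R\subseteq Q$, $\operatorname{DE}(R)$ is a face of dimension $d$ of $\operatorname{SE}(C_{2n})$ if and only if $|R|=d+1$, $|R\cap Q^+|<n$, $|R\cap Q^-|<n$ and $(R\cap Q^+)\cap(-(R\cap Q^-))=\emptyset$. Moreover $$f_d=\sum_{i\in I}\binom{2n}{i}\binom{2n-i}{d+1-i}=\binom{2n}{d+1}\sum_{i\in I}\binom{d+1}{i},$$ where $I=\{i\in\mathbb Z : 0\le i\le d+1,\ i<n,\ d+1-i<n\}$. If $d+1<n$, then $\sum_{i\in I}\binom{d+1}{i}=2^{d+1}$ and $f_d=\binom{2n}{d+1}2^{d+1}$. -/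

import Mathlib

/-- The directed edge polytope of the loopless quiver with vertex set `V` and edge set `E`: the
convex hull in `ℝ^V` of the vectors `e_v - e_w`, for `(v, w) ∈ E`. Quivers with the same vertex set
(in particular the subquivers containing all vertices) are identified with their edge sets. -/
def directedEdgePolytope {V : Type*} [DecidableEq V] (E : Set (V × V)) : Set (V → ℝ) :=
  convexHull ℝ ((fun e : V × V => (Pi.single e.1 1 - Pi.single e.2 1 : V → ℝ)) '' E)

/-- The edge set of the double of a simple graph: both orientations of every edge. -/
def doubleEdges {V : Type*} (G : SimpleGraph V) : Set (V × V) := {e | G.Adj e.1 e.2}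

/-- The symmetric edge polytope of a simple graph. -/
def symmetricEdgePolytope {V : Type*} [DecidableEq V] (G : SimpleGraph V) : Set (V → ℝ) :=
  directedEdgePolytope (doubleEdges G)

/-- The dimension of a nonempty convex set: the dimension of its affine span. -/
noncomputable def polytopeDim {V : Type*} (P : Set (V → ℝ)) : ℕ :=
  Module.finrank ℝ (vectorSpan ℝ P)

/-- `F` is a nonempty face of the polytope `P`, of dimension `d`. A nonempty face is the set of
maximizers on `P` of some linear functional. -/
def IsFaceOfDim {V : Type*} (P : Set (V → ℝ)) (d : ℕ) (F : Set (V → ℝ)) : Prop :=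
  F.Nonempty ∧ IsExposed ℝ P F ∧ polytopeDim F = d

/-- `F` is a facet of `P`: a nonempty face of codimension one. -/
def IsFacet {V : Type*} (P F : Set (V → ℝ)) : Prop :=
  ∃ d : ℕ, IsFaceOfDim P d F ∧ d + 1 = polytopeDim P

/-- The number of `d`-dimensional faces of `P`. -/
noncomputable def faceNumber {V : Type*} (P : Set (V → ℝ)) (d : ℕ) : ℕ :=
  {F | IsFaceOfDim P d F}.ncard

/-- `F` is a `d`-simplex: the convex hull of `d + 1` affinely independent points. -/
def IsSimplexOfDim {V : Type*} (d : ℕ) (F : Set (V → ℝ)) : Prop :=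
  ∃ p : Fin (d + 1) → (V → ℝ), AffineIndependent ℝ p ∧ F = convexHull ℝ (Set.range p)

/-- The edges `(i, i + 1)` of the double of the cycle on `Fin m`, indices being cyclic. -/
def cycleEdgesPos (m : ℕ) : Set (Fin m × Fin m) := {e | e.2 = finRotate m e.1}

/-- The edges `(i + 1, i)` of the double of the cycle on `Fin m`, indices being cyclic. -/
def cycleEdgesNeg (m : ℕ) : Set (Fin m × Fin m) := {e | e.1 = finRotate m e.2}

/-- The integers `i` with `i < n` and `d + 1 - i < n` for which moreover `0 ≤ i ≤ d + 1` (for the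
other ones, the binomial coefficient of `d + 1` over `i` vanishes). -/
def evenCycleIndex (n d : ℕ) : Finset ℕ :=
  (Finset.range (d + 2)).filter fun i => i < n ∧ d + 1 - i < n

/-! The polytope is the hull of the points `±p i`, where `p i = e_i - e_{i+1}`. These `2n` vectors
sum to zero and satisfy no other linear relation, so a functional is the same as a choice of values
`c i` with sum zero (`isLinearCircuit_cycleVector`). From there on only this property is used.

With `M = max |c i|`, the face where the functional is maximal is spanned by the `p i` with `c i =
M` and the `-p i` with `c i = -M`, giving index sets `A` and `B`. If `M > 0`, the zero sum forces
both to have at most `n` elements, and if one has exactly `n`, the other is its complement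
(`card_filter_eq_of_sum_eq_zero`). Conversely, values `1` on `A`, `-1` on `B` and a suitable
constant elsewhere realize every such pair of disjoint sets (`isExposed_of_functional`).

If `A ∪ B` misses an index, the spanning points are linearly independent and the face is a simplex;
the pairs `(A, Aᶜ)` give the facets. A hull determines its pair (`signedHull_inj`), so counting
faces is counting pairs. -/

/-- The convex hull of the points `p i`, for `i ∈ A`, and `-p i`, for `i ∈ B`. -/
def signedHull {ι V : Type*} (p : ι → V → ℝ) (A B : Finset ι) : Set (V → ℝ) :=
  convexHull ℝ (p '' A ∪ (fun i => -p i) '' B)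

/-- The points `p i` sum to zero, and this is the only linear relation between them: every
assignment of values with sum zero extends to a continuous linear functional. -/
structure IsLinearCircuit {ι V : Type*} [Fintype ι] (p : ι → V → ℝ) : Prop where
  sum_eq_zero : ∑ i, p i = 0
  exists_functional : ∀ c : ι → ℝ, ∑ i, c i = 0 → ∃ l : StrongDual ℝ (V → ℝ), ∀ i, l (p i) = c i

/-! ### Faces of a convex hull cut out by a functional -/

theorem sep_convexHull_eq {E : Type*} [AddCommGroup E] [Module ℝ E] (S : Set E)
    (l : E →ₗ[ℝ] ℝ) (M : ℝ) (hM : ∀ x ∈ S, l x ≤ M) :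
    {x ∈ convexHull ℝ S | l x = M} = convexHull ℝ {x ∈ S | l x = M} := by
  have hhyp : convexHull ℝ {x ∈ S | l x = M} ⊆ {x | l x = M} :=
    convexHull_min (fun x hx => hx.2) (convex_hyperplane l.isLinear M)
  apply Set.Subset.antisymm
  -- This union contains `S`, so once it is convex it contains the whole hull; its first piece
  -- misses the hyperplane `l = M`.
  · have hT : Convex ℝ ({x | l x < M} ∪ convexHull ℝ {x ∈ S | l x = M}) := by
      intro x hx y hy a b ha hb hab
      rcases ha.eq_or_lt with rfl | ha
      · obtain rfl : b = 1 := by linarith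
        simpa using hy
      rcases hb.eq_or_lt with rfl | hb
      · obtain rfl : a = 1 := by linarith
        simpa using hx
      have hle : ∀ z ∈ {x | l x < M} ∪ convexHull ℝ {x ∈ S | l x = M}, l z ≤ M := by
        rintro z (hz | hz)
        · exact le_of_lt hz
        · exact le_of_eq (hhyp hz)
      have hMab : M = a * M + b * M := by rw [← add_mul, hab, one_mul]
      have hlx := hle x hx
      rcases hx with hx' | hx'
      · left
        have h1 := mul_lt_mul_of_pos_left (show l x < M from hx') ha
        have h2 := mul_le_mul_of_nonneg_left (hle y hy) hb.le
        simp only [Set.mem_ofPred_eq, map_add, map_smul, smul_eq_mul]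
        linarith
      · rcases hy with hy' | hy'
        · left
          have h1 := mul_lt_mul_of_pos_left (show l y < M from hy') hb
          have h2 := mul_le_mul_of_nonneg_left hlx ha.le
          simp only [Set.mem_ofPred_eq, map_add, map_smul, smul_eq_mul]
          linarith
        · right
          exact convex_convexHull ℝ _ hx' hy' ha.le hb.le hab
    rintro x ⟨hx, hxM⟩
    have hsub : S ⊆ {x | l x < M} ∪ convexHull ℝ {x ∈ S | l x = M} := by
      intro z hz
      rcases (hM z hz).lt_or_eq with h | h
      · exact Or.inl h
      · exact Or.inr (subset_convexHull ℝ _ ⟨hz, h⟩)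
    rcases convexHull_min hsub hT hx with h | h
    · exact absurd hxM (ne_of_lt h)
    · exact h
  · exact fun x hx => ⟨convexHull_mono (fun z hz => hz.1) hx, hhyp hx⟩

theorem vectorSpan_convexHull {E : Type*} [AddCommGroup E] [Module ℝ E] (S : Set E) :
    vectorSpan ℝ (convexHull ℝ S) = vectorSpan ℝ S := by
  rw [← direction_affineSpan, affineSpan_convexHull, direction_affineSpan]

/-! ### Signed hulls and linear circuits -/

section Circuit

variable {ι V : Type*} {p : ι → V → ℝ}

/-- Lets results about the points `p i` and `A` be transferred to `-p i` and `B`. -/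
theorem signedHull_neg (p : ι → V → ℝ) (A B : Finset ι) :
    signedHull (-p) A B = signedHull p B A := by
  unfold signedHull
  congr 1
  rw [Set.union_comm]
  congr 1
  simp

theorem signedHull_mono (p : ι → V → ℝ) {A B A' B' : Finset ι} (hA : A ⊆ A') (hB : B ⊆ B') :
    signedHull p A B ⊆ signedHull p A' B' :=
  convexHull_mono (Set.union_subset_union (Set.image_mono (by simpa using hA))
    (Set.image_mono (by simpa using hB)))

theorem signedHull_nonempty_iff [DecidableEq ι] (p : ι → V → ℝ) (A B : Finset ι) :
    (signedHull p A B).Nonempty ↔ (A ∪ B).Nonempty := by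
  simp [signedHull, Finset.union_nonempty]

theorem le_of_mem_signedHull (l : StrongDual ℝ (V → ℝ)) (M : ℝ) (hM : ∀ i, |l (p i)| ≤ M)
    {A B : Finset ι} {x : V → ℝ} (hx : x ∈ signedHull p A B) : l x ≤ M := by
  refine convexHull_min (t := {x | l x ≤ M}) ?_
    (convex_halfSpace_le l.toLinearMap.isLinear M) hx
  rintro x (⟨i, -, rfl⟩ | ⟨i, -, rfl⟩)
  · exact (abs_le.1 (hM i)).2
  · simpa using neg_le.1 (abs_le.1 (hM i)).1

theorem vectorSpan_signedHull_le (p : ι → V → ℝ) (A B : Finset ι) :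
    vectorSpan ℝ (signedHull p A B) ≤ Submodule.span ℝ (Set.range p) := by
  rw [signedHull, vectorSpan_convexHull, vectorSpan_def, Submodule.span_le]
  have hmem : ∀ x ∈ p '' A ∪ (fun i => -p i) '' B, x ∈ Submodule.span ℝ (Set.range p) := by
    rintro x (⟨i, -, rfl⟩ | ⟨i, -, rfl⟩)
    · exact Submodule.subset_span ⟨i, rfl⟩
    · exact Submodule.neg_mem _ (Submodule.subset_span ⟨i, rfl⟩)
  rintro _ ⟨x, hx, y, hy, rfl⟩
  exact Submodule.sub_mem _ (hmem x hx) (hmem y hy)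

/-- A functional bounded by `M` in absolute value on the points `p i` cuts out the face of
`signedHull p A B` spanned by the points where it takes the value `M`. -/
theorem sep_signedHull_eq (l : StrongDual ℝ (V → ℝ)) (M : ℝ) (hM : ∀ i, |l (p i)| ≤ M)
    (A B : Finset ι) :
    {x ∈ signedHull p A B | l x = M} =
      signedHull p (A.filter fun i => l (p i) = M) (B.filter fun i => l (p i) = -M) := by
  unfold signedHull
  have := sep_convexHull_eq (p '' A ∪ (fun i => -p i) '' B) l.toLinearMap M (by
    rintro x (⟨i, -, rfl⟩ | ⟨i, -, rfl⟩)
    · exact (abs_le.1 (hM i)).2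
    · simpa using neg_le.1 (abs_le.1 (hM i)).1)
  refine this.trans ?_
  congr 1
  ext x
  constructor
  · rintro ⟨⟨i, hi, rfl⟩ | ⟨i, hi, rfl⟩, h⟩
    · exact Or.inl ⟨i, by simpa using ⟨hi, h⟩, rfl⟩
    · exact Or.inr ⟨i, by simpa using ⟨hi, neg_eq_iff_eq_neg.1 ((map_neg l (p i)).symm.trans h)⟩, rfl⟩
  · rintro (⟨i, hi, rfl⟩ | ⟨i, hi, rfl⟩)
    · simp only [Finset.coe_filter, Set.mem_ofPred_eq] at hi
      exact ⟨Or.inl ⟨i, hi.1, rfl⟩, hi.2⟩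
    · simp only [Finset.coe_filter, Set.mem_ofPred_eq] at hi
      exact ⟨Or.inr ⟨i, hi.1, rfl⟩, by simp [hi.2]⟩

variable [Fintype ι]

theorem IsLinearCircuit.neg (hp : IsLinearCircuit p) : IsLinearCircuit (-p) where
  sum_eq_zero := by simp [hp.sum_eq_zero]
  exists_functional c hc := by
    obtain ⟨l, hl⟩ := hp.exists_functional c hc
    exact ⟨-l, fun i => by simp [hl]⟩

theorem maximizers_signedHull_univ (l : StrongDual ℝ (V → ℝ)) (M : ℝ)
    (hM : ∀ i, |l (p i)| ≤ M) (hex : ∃ i, |l (p i)| = M) :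
    {x ∈ signedHull p Finset.univ Finset.univ |
        ∀ y ∈ signedHull p Finset.univ Finset.univ, l y ≤ l x} =
      signedHull p (Finset.univ.filter fun i => l (p i) = M)
        (Finset.univ.filter fun i => l (p i) = -M) := by
  rw [← sep_signedHull_eq l M hM]
  have hmax : ∃ x ∈ signedHull p Finset.univ Finset.univ, l x = M := by
    obtain ⟨i, hi⟩ := hex
    rcases abs_choice (l (p i)) with h | h
    · exact ⟨p i, subset_convexHull ℝ _ (Or.inl ⟨i, by simp, rfl⟩), by rw [← h, hi]⟩
    · exact ⟨-p i, subset_convexHull ℝ _ (Or.inr ⟨i, by simp, rfl⟩), by rw [map_neg, ← h, hi]⟩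
  ext x
  constructor
  · rintro ⟨hx, h⟩
    obtain ⟨y, hy, hyM⟩ := hmax
    exact ⟨hx, le_antisymm (le_of_mem_signedHull l M hM hx) (hyM ▸ h y hy)⟩
  · rintro ⟨hx, h⟩
    exact ⟨hx, fun y hy => h ▸ le_of_mem_signedHull l M hM hy⟩

variable [DecidableEq ι]

/-- Each `p i` is a vertex of the full hull, so it lies in a smaller one only if it is among the
generators. With two indices this fails, since then one point is the negative of the other. -/
theorem IsLinearCircuit.mem_signedHull_iff (hp : IsLinearCircuit p) (hcard : 3 ≤ Fintype.card ι)
    (A B : Finset ι) (i : ι) : p i ∈ signedHull p A B ↔ i ∈ A := by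
  refine ⟨fun h => ?_, fun h => subset_convexHull ℝ _ (Or.inl ⟨i, h, rfl⟩)⟩
  have hk : (3 : ℝ) ≤ Fintype.card ι := by exact_mod_cast hcard
  set k : ℝ := (Fintype.card ι : ℝ) with hkdef
  have hk1 : k - 1 ≠ 0 := by linarith
  -- The values are `1` at `i` and `-1 / (k - 1)` elsewhere; `3 ≤ k` makes the latter less than `1`
  -- in absolute value.
  obtain ⟨l, hl⟩ := hp.exists_functional
    (fun j => (if j = i then k / (k - 1) else 0) - 1 / (k - 1)) (by
      rw [Finset.sum_sub_distrib, Finset.sum_ite_eq' Finset.univ i]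
      simp [k]
      ring)
  have hli : l (p i) = 1 := by rw [hl, if_pos rfl]; field_simp
  have hlj : ∀ j, j ≠ i → |l (p j)| < 1 := by
    intro j hj
    rw [hl, if_neg hj, zero_sub, abs_neg, abs_of_nonneg (by apply div_nonneg <;> linarith),
      div_lt_one (by linarith)]
    linarith
  have hM : ∀ j, |l (p j)| ≤ 1 := fun j => by
    by_cases hj : j = i
    · simp [hj, hli]
    · exact (hlj j hj).le
  have hmem : p i ∈ {x ∈ signedHull p A B | l x = 1} := ⟨h, hli⟩
  rw [sep_signedHull_eq l 1 hM] at hmem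
  obtain ⟨j, hj⟩ := (signedHull_nonempty_iff p _ _).1 ⟨_, hmem⟩
  have hji : j = i := by
    by_contra hne
    have hlt := abs_lt.1 (hlj j hne)
    simp only [Finset.mem_union, Finset.mem_filter] at hj
    rcases hj with hj | hj <;> linarith [hj.2]
  subst hji
  simp only [Finset.mem_union, Finset.mem_filter] at hj
  rcases hj with hj | hj
  · exact hj.1
  · linarith [hj.2]

theorem IsLinearCircuit.signedHull_inj (hp : IsLinearCircuit p) (hcard : 3 ≤ Fintype.card ι)
    {A B A' B' : Finset ι} (h : signedHull p A B = signedHull p A' B') : A = A' ∧ B = B' := by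
  constructor
  · ext i
    rw [← hp.mem_signedHull_iff hcard A B, h, hp.mem_signedHull_iff hcard]
  · ext i
    rw [← hp.neg.mem_signedHull_iff hcard B A, signedHull_neg, h, ← signedHull_neg,
      hp.neg.mem_signedHull_iff hcard]

/-! ### Dimensions -/

theorem IsLinearCircuit.linearIndependent (hp : IsLinearCircuit p) (s : Finset ι)
    (hs : s ≠ Finset.univ) (ε : ι → ℝ) (hε : ∀ i, ε i ≠ 0) :
    LinearIndependent ℝ fun i : s => ε i • p i := by
  obtain ⟨j, hj⟩ : ∃ j, j ∉ s := by
    simpa [Finset.eq_univ_iff_forall] using hs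
  rw [Fintype.linearIndependent_iff]
  intro g hg i
  -- The omitted index `j` absorbs the value `-1`, so on `s` this functional isolates the
  -- coefficient of `i`.
  obtain ⟨l, hl⟩ := hp.exists_functional (Pi.single i.1 1 - Pi.single j 1) (by simp)
  have h := congrArg l hg
  simp only [map_sum, map_smul, hl, map_zero, smul_eq_mul, Pi.sub_apply] at h
  rw [Finset.sum_eq_single i] at h
  · have hij : i.1 ≠ j := fun h => hj (h ▸ i.2)
    simpa [hij, hε] using h
  · intro k _ hk
    have hkj : k.1 ≠ j := fun h => hj (h ▸ k.2)
    have hki : k.1 ≠ i.1 := fun h => hk (Subtype.ext h)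
    simp [hkj, hki]
  · simp

theorem IsLinearCircuit.exists_affineIndependent (hp : IsLinearCircuit p) {A B : Finset ι}
    (hAB : Disjoint A B) (hne : A ∪ B ≠ Finset.univ) :
    ∃ q : ↥(A ∪ B) → V → ℝ, AffineIndependent ℝ q ∧
      p '' A ∪ (fun i => -p i) '' B = Set.range q := by
  refine ⟨fun i => (if i.1 ∈ A then (1 : ℝ) else -1) • p i,
    (hp.linearIndependent (A ∪ B) hne (fun i => if i ∈ A then 1 else -1)
      (fun i => by split_ifs <;> norm_num)).affineIndependent, ?_⟩
  ext x
  constructor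
  · rintro (⟨i, hi, rfl⟩ | ⟨i, hi, rfl⟩)
    · exact ⟨⟨i, Finset.mem_union_left _ hi⟩, by simp [Finset.mem_coe.1 hi]⟩
    · exact ⟨⟨i, Finset.mem_union_right _ hi⟩, by
        simp [Finset.disjoint_right.1 hAB (Finset.mem_coe.1 hi)]⟩
  · rintro ⟨⟨i, hi⟩, rfl⟩
    by_cases hA : i ∈ A
    · exact Or.inl ⟨i, hA, by simp [hA]⟩
    · exact Or.inr ⟨i, (Finset.mem_union.1 hi).resolve_left hA, by simp [hA]⟩

theorem IsLinearCircuit.isSimplexOfDim (hp : IsLinearCircuit p) {A B : Finset ι} {d : ℕ}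
    (hAB : Disjoint A B) (hne : A ∪ B ≠ Finset.univ) (hd : A.card + B.card = d + 1) :
    IsSimplexOfDim d (signedHull p A B) := by
  obtain ⟨q, hq, hr⟩ := hp.exists_affineIndependent hAB hne
  have hc : Fintype.card (Fin (d + 1)) = Fintype.card ↥(A ∪ B) := by
    rw [Fintype.card_fin, Fintype.card_coe, Finset.card_union_of_disjoint hAB, hd]
  let e := Fintype.equivOfCardEq hc
  refine ⟨q ∘ e, hq.comp_embedding e.toEmbedding, ?_⟩
  rw [e.surjective.range_comp, ← hr, signedHull]

theorem IsLinearCircuit.polytopeDim_signedHull (hp : IsLinearCircuit p) {A B : Finset ι} {d : ℕ}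
    (hAB : Disjoint A B) (hne : A ∪ B ≠ Finset.univ) (hd : A.card + B.card = d + 1) :
    polytopeDim (signedHull p A B) = d := by
  obtain ⟨q, hq, hr⟩ := hp.exists_affineIndependent hAB hne
  rw [polytopeDim, signedHull, vectorSpan_convexHull, hr]
  apply hq.finrank_vectorSpan
  rw [Fintype.card_coe, Finset.card_union_of_disjoint hAB, hd]

/-- All points but one form a basis of the span; the omitted one is minus the sum of the others. -/
theorem IsLinearCircuit.finrank_span (hp : IsLinearCircuit p) [Nonempty ι] :
    Module.finrank ℝ (Submodule.span ℝ (Set.range p)) = Fintype.card ι - 1 := by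
  obtain ⟨j⟩ := ‹Nonempty ι›
  have hli := hp.linearIndependent (Finset.univ.erase j)
    (fun h => Finset.notMem_erase j Finset.univ (h.symm ▸ Finset.mem_univ j)) (fun _ => 1)
    (fun _ => one_ne_zero)
  have hspan : Submodule.span ℝ (Set.range p) = Submodule.span ℝ
      (Set.range fun i : ↥(Finset.univ.erase j) => (1 : ℝ) • p i) := by
    apply le_antisymm
    · have hmem : ∀ i, i ≠ j → p i ∈ Submodule.span ℝ
          (Set.range fun i : ↥(Finset.univ.erase j) => (1 : ℝ) • p i) := fun i hi =>
        Submodule.subset_span ⟨⟨i, by simpa using hi⟩, by simp⟩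
      rw [Submodule.span_le]
      rintro _ ⟨i, rfl⟩
      by_cases hi : i = j
      · subst hi
        have h := Finset.add_sum_erase Finset.univ p (Finset.mem_univ i)
        rw [hp.sum_eq_zero] at h
        rw [eq_neg_of_add_eq_zero_left h]
        exact Submodule.neg_mem _ (Submodule.sum_mem _ fun k hk => hmem k (Finset.ne_of_mem_erase hk))
      · exact hmem i hi
    · rw [Submodule.span_le]
      rintro _ ⟨i, rfl⟩
      exact Submodule.smul_mem _ _ (Submodule.subset_span ⟨i, rfl⟩)
  rw [hspan, finrank_span_eq_card hli, Fintype.card_coe, Finset.card_erase_of_mem (Finset.mem_univ j),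
    Finset.card_univ]

theorem IsLinearCircuit.polytopeDim_univ (hp : IsLinearCircuit p) [Nonempty ι] :
    polytopeDim (signedHull p Finset.univ Finset.univ) = Fintype.card ι - 1 := by
  have heq : vectorSpan ℝ (signedHull p Finset.univ Finset.univ) =
      Submodule.span ℝ (Set.range p) := by
    refine le_antisymm (vectorSpan_signedHull_le p _ _) ?_
    rw [Submodule.span_le]
    rintro _ ⟨i, rfl⟩
    -- The difference of the two opposite vertices is `2 • p i`.
    have h : p i -ᵥ (-p i) ∈ vectorSpan ℝ (signedHull p Finset.univ Finset.univ) :=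
      vsub_mem_vectorSpan ℝ (subset_convexHull ℝ _ (Or.inl ⟨i, by simp, rfl⟩))
        (subset_convexHull ℝ _ (Or.inr ⟨i, by simp, rfl⟩))
    have h2 := Submodule.smul_mem _ (2⁻¹ : ℝ) h
    rwa [vsub_eq_sub, sub_neg_eq_add, ← two_smul ℝ, inv_smul_smul₀ two_ne_zero] at h2
  rw [polytopeDim, heq, hp.finrank_span]

/-- Upper bound: a functional equal to `1` on all generators kills the direction space but not `p
a`, so that space is proper in the span. Lower bound: dropping one generator leaves a simplex with
`2n - 1` vertices. -/
theorem IsLinearCircuit.polytopeDim_compl (hp : IsLinearCircuit p) {n : ℕ} (hn : 2 ≤ n)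
    (hcard : Fintype.card ι = 2 * n) {A : Finset ι} (hA : A.card = n) :
    polytopeDim (signedHull p A Aᶜ) = 2 * n - 2 := by
  have hAc : Aᶜ.card = n := by rw [Finset.card_compl]; omega
  obtain ⟨a, ha⟩ : A.Nonempty := Finset.card_pos.1 (by omega)
  have : Nonempty ι := ⟨a⟩
  have : Module.Finite ℝ (Submodule.span ℝ (Set.range p)) :=
    Module.Finite.span_of_finite ℝ (Set.finite_range p)
  have hle := vectorSpan_signedHull_le p A Aᶜ
  apply le_antisymm
  · obtain ⟨l, hl⟩ := hp.exists_functional (fun i => if i ∈ A then 1 else -1) (by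
      rw [Finset.sum_ite]
      simp [hA, ← Finset.compl_filter, hAc])
    have hker : vectorSpan ℝ (signedHull p A Aᶜ) ≤ LinearMap.ker l.toLinearMap := by
      rw [signedHull, vectorSpan_convexHull, vectorSpan_def, Submodule.span_le]
      have hone : ∀ x ∈ p '' A ∪ (fun i => -p i) '' (Aᶜ : Finset ι), l x = 1 := by
        rintro x (⟨i, hi, rfl⟩ | ⟨i, hi, rfl⟩)
        · rw [hl, if_pos (by simpa using hi)]
        · rw [map_neg, hl, if_neg (by simpa using hi), neg_neg]
      rintro _ ⟨x, hx, y, hy, rfl⟩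
      simp [hone x hx, hone y hy]
    have hlt : vectorSpan ℝ (signedHull p A Aᶜ) < Submodule.span ℝ (Set.range p) := by
      refine lt_of_le_of_ne hle fun h => ?_
      have hpa : p a ∈ LinearMap.ker l.toLinearMap :=
        hker (h ▸ Submodule.subset_span ⟨a, rfl⟩)
      have : l (p a) = 0 := hpa
      rw [hl, if_pos ha] at this
      exact one_ne_zero this
    have := Submodule.finrank_lt_finrank_of_lt hlt
    rw [hp.finrank_span, hcard] at this
    rw [polytopeDim]
    omega
  · have hc : (A.erase a).card = n - 1 := by rw [Finset.card_erase_of_mem ha, hA]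
    rw [← hp.polytopeDim_signedHull (A := A.erase a) (B := Aᶜ) (d := 2 * n - 2)
      (disjoint_compl_right.mono_left (Finset.erase_subset a A))
      (fun h => by
        have : a ∈ A.erase a ∪ Aᶜ := h ▸ Finset.mem_univ a
        simp [ha] at this)
      (by omega)]
    have : Module.Finite ℝ (vectorSpan ℝ (signedHull p A Aᶜ)) :=
      Submodule.finiteDimensional_of_le hle
    exact Submodule.finrank_mono
      (vectorSpan_mono ℝ (signedHull_mono p (Finset.erase_subset a A) subset_rfl))

/-! ### Faces -/

/-- The nonnegative numbers `c i + M` add up to `2nM`, and each index with `c i = M` contributes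
`2M`. So there are at most `n` such indices, and if there are `n`, all other terms vanish. -/
theorem card_filter_eq_of_sum_eq_zero {n : ℕ} (hcard : Fintype.card ι = 2 * n) (c : ι → ℝ)
    (hc : ∑ i, c i = 0) {M : ℝ} (hM0 : 0 < M) (hM : ∀ i, |c i| ≤ M)
    (h : n ≤ (Finset.univ.filter fun i => c i = M).card) :
    (Finset.univ.filter fun i => c i = M).card = n ∧
      (Finset.univ.filter fun i => c i = -M) = (Finset.univ.filter fun i => c i = M)ᶜ := by
  set A := Finset.univ.filter fun i => c i = M with hA
  have hnn : ∀ i ∈ Aᶜ, 0 ≤ c i + M := fun i _ => by linarith [(abs_le.1 (hM i)).1]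
  have hsum : (A.card : ℝ) * (2 * M) + ∑ i ∈ Aᶜ, (c i + M) = 2 * n * M := by
    have h1 : ∑ i ∈ A, (c i + M) = A.card * (2 * M) := by
      rw [Finset.sum_congr rfl (g := fun _ => 2 * M), Finset.sum_const, nsmul_eq_mul]
      intro i hi
      rw [(Finset.mem_filter.1 hi).2, two_mul]
    rw [← h1, Finset.sum_add_sum_compl, Finset.sum_add_distrib, hc, Finset.sum_const,
      Finset.card_univ, hcard]
    simp
  have hnn' := Finset.sum_nonneg hnn
  have hle : A.card ≤ n := by
    have : (A.card : ℝ) ≤ n := by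
      by_contra hlt
      push Not at hlt
      nlinarith
    exact_mod_cast this
  have hAn : A.card = n := le_antisymm hle h
  refine ⟨hAn, ?_⟩
  have hzero : ∑ i ∈ Aᶜ, (c i + M) = 0 := by rw [hAn] at hsum; linarith
  rw [Finset.sum_eq_zero_iff_of_nonneg hnn] at hzero
  ext i
  constructor
  · intro hi
    simp only [Finset.mem_filter, Finset.mem_univ, true_and] at hi
    simp only [hA, Finset.mem_compl, Finset.mem_filter, Finset.mem_univ, true_and, hi]
    linarith
  · intro hi
    simpa using eq_neg_of_add_eq_zero_left (hzero i hi)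

theorem IsLinearCircuit.eq_signedHull_of_isExposed (hp : IsLinearCircuit p) [Nonempty ι] {n : ℕ}
    (hcard : Fintype.card ι = 2 * n) {F : Set (V → ℝ)} (hF : F.Nonempty)
    (hexp : IsExposed ℝ (signedHull p Finset.univ Finset.univ) F) :
    F = signedHull p Finset.univ Finset.univ ∨
      (∃ A : Finset ι, A.card = n ∧ F = signedHull p A Aᶜ) ∨
      ∃ A B : Finset ι, Disjoint A B ∧ A.card < n ∧ B.card < n ∧ F = signedHull p A B := by
  obtain ⟨l, rfl⟩ := hexp hF
  obtain ⟨i, -, hi⟩ := Finset.exists_max_image Finset.univ (fun i => |l (p i)|)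
    Finset.univ_nonempty
  have hM : ∀ j, |l (p j)| ≤ |l (p i)| := fun j => hi j (Finset.mem_univ j)
  rw [maximizers_signedHull_univ l _ hM ⟨i, rfl⟩]
  have hsum : ∑ j, l (p j) = 0 := by rw [← map_sum, hp.sum_eq_zero, map_zero]
  -- A functional vanishing on all points exposes the whole polytope.
  rcases (abs_nonneg (l (p i))).eq_or_lt with h0 | hpos
  · left
    have hz : ∀ j, l (p j) = 0 := fun j => abs_nonpos_iff.1 (h0 ▸ hM j)
    simp [hz]
  right
  set M := |l (p i)|
  by_cases hA : n ≤ (Finset.univ.filter fun j => l (p j) = M).card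
  · left
    obtain ⟨h1, h2⟩ := card_filter_eq_of_sum_eq_zero hcard (fun j => l (p j)) hsum hpos hM hA
    exact ⟨_, h1, by rw [h2]⟩
  -- Applied to the negated values, the counting lemma would give the value `M` at `n` indices,
  -- which `hA` excludes.
  by_cases hB : n ≤ (Finset.univ.filter fun j => l (p j) = -M).card
  · exfalso
    obtain ⟨h1, h2⟩ := card_filter_eq_of_sum_eq_zero hcard (fun j => -l (p j)) (by simp [hsum]) hpos
      (by simpa using hM) (by simpa only [neg_eq_iff_eq_neg] using hB)
    simp only [neg_eq_iff_eq_neg, neg_neg] at h1 h2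
    apply hA
    rw [h2, Finset.card_compl, h1]
    omega
  · refine Or.inr ⟨_, _, ?_, not_le.1 hA, not_le.1 hB, rfl⟩
    rw [Finset.disjoint_filter]
    intro j _ h1 h2
    linarith

/-- The number `r` is the value given to the indices outside `A ∪ B`; `hsum` says that all values
add up to zero, and `hr` keeps the extra indices off the face. -/
theorem IsLinearCircuit.isExposed_of_functional (hp : IsLinearCircuit p) {A B : Finset ι}
    (hne : (A ∪ B).Nonempty) (hAB : Disjoint A B) (r : ℝ) (hr : A ∪ B ≠ Finset.univ → |r| < 1)
    (hsum : (A.card : ℝ) - B.card + ((A ∪ B)ᶜ.card : ℝ) * r = 0) :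
    IsExposed ℝ (signedHull p Finset.univ Finset.univ) (signedHull p A B) := by
  obtain ⟨l, hl⟩ := hp.exists_functional
    (fun i => if i ∈ A then 1 else if i ∈ B then -1 else r) (by
      rw [← Finset.sum_add_sum_compl (A ∪ B), Finset.sum_union hAB,
        Finset.sum_congr rfl (g := fun _ => (1 : ℝ)) (s₁ := A),
        Finset.sum_congr rfl (g := fun _ => (-1 : ℝ)) (s₁ := B),
        Finset.sum_congr rfl (g := fun _ => r) (s₁ := (A ∪ B)ᶜ)]
      · simp only [Finset.sum_const, nsmul_eq_mul]
        linarith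
      · intro i hi
        simp only [Finset.mem_compl, Finset.mem_union, not_or] at hi
        simp [hi.1, hi.2]
      · intro i hi
        simp [hi, Finset.disjoint_right.1 hAB hi]
      · intro i hi
        simp [hi])
  have hA : ∀ i, i ∈ A → l (p i) = 1 := fun i hi => by simp [hl, hi]
  have hB : ∀ i, i ∈ B → l (p i) = -1 := fun i hi => by
    simp [hl, hi, Finset.disjoint_right.1 hAB hi]
  have hC : ∀ i, i ∉ A → i ∉ B → |l (p i)| < 1 := fun i h1 h2 => by
    rw [hl, if_neg h1, if_neg h2]
    apply hr
    intro h
    have := h ▸ Finset.mem_univ i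
    simp [h1, h2] at this
  refine fun _ => ⟨l, ?_⟩
  rw [maximizers_signedHull_univ l 1]
  · congr 1
    · ext i
      simp only [Finset.mem_filter, Finset.mem_univ, true_and]
      refine ⟨hA i, fun h => ?_⟩
      by_contra h1
      by_cases h2 : i ∈ B
      · linarith [hB i h2]
      · linarith [(abs_lt.1 (hC i h1 h2)).2]
    · ext i
      simp only [Finset.mem_filter, Finset.mem_univ, true_and]
      refine ⟨hB i, fun h => ?_⟩
      by_contra h2
      by_cases h1 : i ∈ A
      · linarith [hA i h1]
      · linarith [(abs_lt.1 (hC i h1 h2)).1]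
  · intro i
    by_cases h1 : i ∈ A
    · simp [hA i h1]
    by_cases h2 : i ∈ B
    · simp [hB i h2]
    exact (hC i h1 h2).le
  · obtain ⟨i, hi⟩ := hne
    refine ⟨i, ?_⟩
    rcases Finset.mem_union.1 hi with h | h
    · simp [hA i h]
    · simp [hB i h]

theorem IsLinearCircuit.isExposed_compl (hp : IsLinearCircuit p) {n : ℕ} (hn : 2 ≤ n)
    (hcard : Fintype.card ι = 2 * n) {A : Finset ι} (hA : A.card = n) :
    IsExposed ℝ (signedHull p Finset.univ Finset.univ) (signedHull p A Aᶜ) := by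
  have hAc : Aᶜ.card = n := by rw [Finset.card_compl]; omega
  refine hp.isExposed_of_functional ?_ disjoint_compl_right 0 (by simp) ?_
  · exact (Finset.card_pos.1 (by omega : 0 < A.card)).mono Finset.subset_union_left
  · simp [hA, hAc]

theorem IsLinearCircuit.isExposed_of_card_lt (hp : IsLinearCircuit p) {n : ℕ}
    (hcard : Fintype.card ι = 2 * n) {A B : Finset ι} (hAB : Disjoint A B)
    (hne : (A ∪ B).Nonempty) (hA : A.card < n) (hB : B.card < n) :
    IsExposed ℝ (signedHull p Finset.univ Finset.univ) (signedHull p A B) := by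
  have hk : ((A ∪ B)ᶜ.card : ℝ) = 2 * n - A.card - B.card := by
    have h := Finset.card_add_card_compl (A ∪ B)
    rw [hcard, Finset.card_union_of_disjoint hAB] at h
    have h' : ((A.card + B.card + (A ∪ B)ᶜ.card : ℕ) : ℝ) = (2 * n : ℕ) := by rw [h]
    push_cast at h'
    linarith
  have hA' : (A.card : ℝ) < n := by exact_mod_cast hA
  have hB' : (B.card : ℝ) < n := by exact_mod_cast hB
  have hpos : (0 : ℝ) < 2 * n - A.card - B.card := by linarith
  -- This `r` is the solution of the zero-sum equation; `|r| < 1` amounts to `A.card < n` and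
  -- `B.card < n`.
  refine hp.isExposed_of_functional hne hAB
    (((B.card : ℝ) - A.card) / (2 * n - A.card - B.card)) (fun _ => ?_) ?_
  · rw [abs_lt, lt_div_iff₀ hpos, div_lt_iff₀ hpos]
    constructor <;> linarith
  · rw [hk, mul_div_cancel₀ _ hpos.ne']
    ring

theorem IsLinearCircuit.isFaceOfDim_facet_iff (hp : IsLinearCircuit p) {n : ℕ} (hn : 2 ≤ n)
    (hcard : Fintype.card ι = 2 * n) (F : Set (V → ℝ)) :
    IsFaceOfDim (signedHull p Finset.univ Finset.univ) (2 * n - 2) F ↔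
      ∃ A : Finset ι, A.card = n ∧ F = signedHull p A Aᶜ := by
  have : Nonempty ι := Fintype.card_pos_iff.1 (by omega)
  constructor
  · rintro ⟨hF, hexp, hdim⟩
    rcases hp.eq_signedHull_of_isExposed hcard hF hexp with rfl | h | ⟨A, B, hAB, hA, hB, rfl⟩
    · rw [hp.polytopeDim_univ, hcard] at hdim
      omega
    · exact h
    · rw [signedHull_nonempty_iff, ← Finset.card_pos, Finset.card_union_of_disjoint hAB] at hF
      -- Such a simplex has at most `2n - 2` vertices, so its dimension is too small for a facet.
      rw [hp.polytopeDim_signedHull (d := A.card + B.card - 1) hAB _ (by omega)] at hdim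
      · omega
      · intro h
        have := Finset.card_union_of_disjoint hAB
        rw [h, Finset.card_univ, hcard] at this
        omega
  · rintro ⟨A, hA, rfl⟩
    refine ⟨?_, hp.isExposed_compl hn hcard hA, hp.polytopeDim_compl hn hcard hA⟩
    rw [signedHull_nonempty_iff]
    exact (Finset.card_pos.1 (by omega : 0 < A.card)).mono Finset.subset_union_left

theorem IsLinearCircuit.isFaceOfDim_iff (hp : IsLinearCircuit p) {n d : ℕ} (hn : 2 ≤ n)
    (hcard : Fintype.card ι = 2 * n) (hd : d < 2 * n - 2) (F : Set (V → ℝ)) :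
    IsFaceOfDim (signedHull p Finset.univ Finset.univ) d F ↔
      ∃ A B : Finset ι, Disjoint A B ∧ A.card < n ∧ B.card < n ∧ A.card + B.card = d + 1 ∧
        F = signedHull p A B := by
  have : Nonempty ι := Fintype.card_pos_iff.1 (by omega)
  have hne : ∀ A B : Finset ι, Disjoint A B → A.card < n → B.card < n → A ∪ B ≠ Finset.univ := by
    intro A B hAB hA hB h
    have := Finset.card_union_of_disjoint hAB
    rw [h, Finset.card_univ, hcard] at this
    omega
  constructor
  · rintro ⟨hF, hexp, hdim⟩
    rcases hp.eq_signedHull_of_isExposed hcard hF hexp with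
      rfl | ⟨A, hA, rfl⟩ | ⟨A, B, hAB, hA, hB, rfl⟩
    · rw [hp.polytopeDim_univ, hcard] at hdim
      omega
    · rw [hp.polytopeDim_compl hn hcard hA] at hdim
      omega
    · rw [signedHull_nonempty_iff, ← Finset.card_pos, Finset.card_union_of_disjoint hAB] at hF
      rw [hp.polytopeDim_signedHull (d := A.card + B.card - 1) hAB (hne A B hAB hA hB)
        (by omega)] at hdim
      exact ⟨A, B, hAB, hA, hB, by omega, rfl⟩
  · rintro ⟨A, B, hAB, hA, hB, hABd, rfl⟩
    have hnon : (A ∪ B).Nonempty := by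
      rw [← Finset.card_pos, Finset.card_union_of_disjoint hAB]
      omega
    exact ⟨(signedHull_nonempty_iff p A B).2 hnon, hp.isExposed_of_card_lt hcard hAB hnon hA hB,
      hp.polytopeDim_signedHull hAB (hne A B hAB hA hB) hABd⟩

theorem IsLinearCircuit.isSimplexOfDim_of_isFaceOfDim (hp : IsLinearCircuit p) {n d : ℕ}
    (hn : 2 ≤ n) (hcard : Fintype.card ι = 2 * n) (hd : d < 2 * n - 2) {F : Set (V → ℝ)}
    (hF : IsFaceOfDim (signedHull p Finset.univ Finset.univ) d F) : IsSimplexOfDim d F := by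
  obtain ⟨A, B, hAB, hA, hB, hABd, rfl⟩ := (hp.isFaceOfDim_iff hn hcard hd F).1 hF
  refine hp.isSimplexOfDim hAB (fun h => ?_) hABd
  have := Finset.card_union_of_disjoint hAB
  rw [h, Finset.card_univ, hcard] at this
  omega

/-! ### Counting faces -/

theorem IsLinearCircuit.faceNumber_facet (hp : IsLinearCircuit p) {n : ℕ} (hn : 2 ≤ n)
    (hcard : Fintype.card ι = 2 * n) :
    faceNumber (signedHull p Finset.univ Finset.univ) (2 * n - 2) = (2 * n).choose n := by
  have h : {F | IsFaceOfDim (signedHull p Finset.univ Finset.univ) (2 * n - 2) F} =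
      (fun A : Finset ι => signedHull p A Aᶜ) '' (Finset.powersetCard n (Finset.univ : Finset ι)) := by
    ext F
    simp only [Set.mem_ofPred_eq, hp.isFaceOfDim_facet_iff hn hcard, Set.mem_image, Finset.mem_coe,
      Finset.mem_powersetCard_univ, eq_comm]
  rw [faceNumber, h, Set.ncard_image_of_injective _
    (fun A A' hAA => (hp.signedHull_inj (by omega) hAA).1), Set.ncard_coe_finset,
    Finset.card_powersetCard, Finset.card_univ, hcard]

theorem IsLinearCircuit.faceNumber_eq_sum (hp : IsLinearCircuit p) {n d : ℕ} (hn : 2 ≤ n)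
    (hcard : Fintype.card ι = 2 * n) (hd : d < 2 * n - 2) :
    faceNumber (signedHull p Finset.univ Finset.univ) d =
      ∑ i ∈ evenCycleIndex n d, (2 * n).choose i * (2 * n - i).choose (d + 1 - i) := by
  -- The first component records the size of `A`, so that the cardinality of `T` is the required sum
  -- over sizes.
  let T : Finset (Σ _ : ℕ, Σ _ : Finset ι, Finset ι) := (evenCycleIndex n d).sigma fun i =>
    (Finset.powersetCard i Finset.univ).sigma fun A => Finset.powersetCard (d + 1 - i) Aᶜ
  have hmem : ∀ t, t ∈ T ↔ t.1 ∈ evenCycleIndex n d ∧ t.2.1.card = t.1 ∧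
      Disjoint t.2.1 t.2.2 ∧ t.2.2.card = d + 1 - t.1 := by
    rintro ⟨i, A, B⟩
    simp only [T, Finset.mem_sigma, Finset.mem_powersetCard, Finset.subset_univ, true_and,
      Finset.subset_compl_iff_disjoint_left]
  have h : {F | IsFaceOfDim (signedHull p Finset.univ Finset.univ) d F} =
      (fun t : Σ _ : ℕ, Σ _ : Finset ι, Finset ι => signedHull p t.2.1 t.2.2) '' T := by
    ext F
    simp only [Set.mem_ofPred_eq, hp.isFaceOfDim_iff hn hcard hd, Set.mem_image, Finset.mem_coe,
      hmem]
    constructor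
    · rintro ⟨A, B, hAB, hA, hB, hABd, rfl⟩
      refine ⟨⟨A.card, A, B⟩, ⟨?_, rfl, hAB, by dsimp only; omega⟩, rfl⟩
      simp only [evenCycleIndex, Finset.mem_filter, Finset.mem_range]
      omega
    · rintro ⟨⟨i, A, B⟩, ⟨hi, hA, hAB, hB⟩, rfl⟩
      simp only [evenCycleIndex, Finset.mem_filter, Finset.mem_range] at hi hA hB
      exact ⟨A, B, hAB, by omega, by omega, by omega, rfl⟩
  rw [faceNumber, h, Set.InjOn.ncard_image, Set.ncard_coe_finset, Finset.card_sigma]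
  · refine Finset.sum_congr rfl fun i _ => ?_
    rw [Finset.card_sigma, Finset.sum_congr rfl (g := fun _ => (2 * n - i).choose (d + 1 - i)),
      Finset.sum_const, Finset.card_powersetCard, Finset.card_univ, hcard, smul_eq_mul]
    intro A hA
    rw [Finset.card_powersetCard, Finset.card_compl, hcard, (Finset.mem_powersetCard.1 hA).2]
  · rintro ⟨i, A, B⟩ ht ⟨i', A', B'⟩ ht' hF
    obtain ⟨rfl, rfl⟩ := hp.signedHull_inj (by omega) hF
    have hi : A.card = i := ((hmem _).1 ht).2.1
    have hi' : A.card = i' := ((hmem _).1 ht').2.1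
    obtain rfl := hi.symm.trans hi'
    rfl

end Circuit

theorem sum_evenCycleIndex_choose_mul (n d : ℕ) :
    ∑ i ∈ evenCycleIndex n d, (2 * n).choose i * (2 * n - i).choose (d + 1 - i) =
      (2 * n).choose (d + 1) * ∑ i ∈ evenCycleIndex n d, (d + 1).choose i := by
  rw [Finset.mul_sum]
  refine Finset.sum_congr rfl fun i hi => ?_
  simp only [evenCycleIndex, Finset.mem_filter, Finset.mem_range] at hi
  exact (Nat.choose_mul (by omega : i ≤ d + 1)).symm

/-- For `d + 1 < n` both size constraints are automatic, leaving a full row of binomial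
coefficients. -/
theorem sum_evenCycleIndex_choose {n d : ℕ} (hd : d + 1 < n) :
    ∑ i ∈ evenCycleIndex n d, (d + 1).choose i = 2 ^ (d + 1) := by
  rw [evenCycleIndex, Finset.filter_true_of_mem, Nat.sum_range_choose]
  intro i hi
  rw [Finset.mem_range] at hi
  omega

/-! ### The cycle -/

/-- The vector `e_i - e_{i + 1}`, indices being cyclic. -/
def cycleVector (m : ℕ) (i : Fin m) : Fin m → ℝ :=
  Pi.single i 1 - Pi.single (finRotate m i) 1

/-- The edges `(i, i + 1)` for `i ∈ A` together with the edges `(i + 1, i)` for `i ∈ B`. -/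
def orientedEdges {m : ℕ} (A B : Finset (Fin m)) : Set (Fin m × Fin m) :=
  (fun i => (i, finRotate m i)) '' A ∪ (fun i => (finRotate m i, i)) '' B

theorem isLinearCircuit_cycleVector (m : ℕ) : IsLinearCircuit (cycleVector m) where
  sum_eq_zero := by
    simp only [cycleVector, Finset.sum_sub_distrib]
    rw [Equiv.sum_comp (finRotate m) fun i => (Pi.single i 1 : Fin m → ℝ), sub_self]
  exists_functional c hc := by
    -- A potential with `y i - y (i + 1) = c i`, built from partial sums; the zero sum of `c` is
    -- needed only where the cycle closes up, at the last index.
    let y : Fin m → ℝ := fun i => -∑ j ∈ Finset.univ.filter (· < i), c j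
    refine ⟨∑ i, y i • ContinuousLinearMap.proj i, fun i => ?_⟩
    have hval : (∑ k, y k • (ContinuousLinearMap.proj k : StrongDual ℝ (Fin m → ℝ)))
        (cycleVector m i) = y i - y (finRotate m i) := by
      simp [cycleVector, mul_sub, Finset.sum_sub_distrib, Pi.single_apply]
    rw [hval]
    cases m with
    | zero => exact i.elim0
    | succ k =>
      by_cases hi : i = Fin.last k
      · subst hi
        rw [finRotate_last]
        have h1 : (Finset.univ.filter fun j : Fin (k + 1) => j < Fin.last k) =
            Finset.univ.erase (Fin.last k) := by
          ext j
          simp [Fin.lt_last_iff_ne_last]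
        have h2 := Finset.add_sum_erase Finset.univ c (Finset.mem_univ (Fin.last k))
        simp only [y, h1, Fin.not_lt_zero, Finset.filter_false, Finset.sum_empty]
        linarith
      · have h1 : (Finset.univ.filter fun j : Fin (k + 1) => j < finRotate (k + 1) i) =
            insert i (Finset.univ.filter (· < i)) := by
          ext j
          simp only [Finset.mem_filter, Finset.mem_univ, true_and, Finset.mem_insert, Fin.lt_def,
            Fin.ext_iff, coe_finRotate_of_ne_last hi]
          omega
        simp only [y]
        rw [h1, Finset.sum_insert (by simp)]
        ring

theorem directedEdgePolytope_orientedEdges {m : ℕ} (A B : Finset (Fin m)) :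
    directedEdgePolytope (orientedEdges A B) = signedHull (cycleVector m) A B := by
  simp only [directedEdgePolytope, orientedEdges, signedHull, Set.image_union, Set.image_image,
    cycleVector, neg_sub]
  rfl

/-- Ensures that no edge is both positive and negative, which would happen on a cycle of length two.
-/
theorem finRotate_finRotate_ne {m : ℕ} (hm : 3 ≤ m) (i : Fin m) :
    finRotate m (finRotate m i) ≠ i := by
  obtain ⟨k, rfl⟩ : ∃ k, m = k + 1 := ⟨m - 1, by omega⟩
  intro h
  have h1 := coe_finRotate (finRotate (k + 1) i)
  have h2 := coe_finRotate i
  simp only [Nat.succ_eq_add_one, h, Fin.ext_iff, Fin.val_last] at h1 h2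
  have := i.2
  split_ifs at h1 h2 <;> omega

theorem mk_finRotate_mem_orientedEdges {m : ℕ} (hm : 3 ≤ m) {A B : Finset (Fin m)} {i : Fin m} :
    (i, finRotate m i) ∈ orientedEdges A B ↔ i ∈ A := by
  constructor
  · rintro (⟨j, hj, h⟩ | ⟨j, hj, h⟩)
    · rw [← (Prod.mk.inj h).1]
      exact hj
    · obtain ⟨h1, h2⟩ := Prod.mk.inj h
      exact absurd (h2 ▸ h1 : finRotate m (finRotate m i) = i) (finRotate_finRotate_ne hm i)
  · exact fun h => Or.inl ⟨i, h, rfl⟩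

theorem finRotate_mk_mem_orientedEdges {m : ℕ} (hm : 3 ≤ m) {A B : Finset (Fin m)} {i : Fin m} :
    (finRotate m i, i) ∈ orientedEdges A B ↔ i ∈ B := by
  constructor
  · rintro (⟨j, hj, h⟩ | ⟨j, hj, h⟩)
    · obtain ⟨h1, h2⟩ := Prod.mk.inj h
      exact absurd (h1 ▸ h2 : finRotate m (finRotate m i) = i) (finRotate_finRotate_ne hm i)
    · rw [← (Prod.mk.inj h).2]
      exact hj
  · exact fun h => Or.inr ⟨i, h, rfl⟩

theorem orientedEdges_inter_cycleEdgesPos {m : ℕ} (hm : 3 ≤ m) (A B : Finset (Fin m)) :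
    orientedEdges A B ∩ cycleEdgesPos m = (fun i => (i, finRotate m i)) '' (A : Set (Fin m)) := by
  ext ⟨v, w⟩
  constructor
  · rintro ⟨h, hvw⟩
    obtain rfl : w = finRotate m v := hvw
    exact ⟨v, (mk_finRotate_mem_orientedEdges hm).1 h, rfl⟩
  · rintro ⟨i, hi, h⟩
    rw [← h]
    exact ⟨Or.inl ⟨i, hi, rfl⟩, rfl⟩

theorem orientedEdges_inter_cycleEdgesNeg {m : ℕ} (hm : 3 ≤ m) (A B : Finset (Fin m)) :
    orientedEdges A B ∩ cycleEdgesNeg m = (fun i => (finRotate m i, i)) '' (B : Set (Fin m)) := by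
  ext ⟨v, w⟩
  constructor
  · rintro ⟨h, hvw⟩
    obtain rfl : v = finRotate m w := hvw
    exact ⟨w, (finRotate_mk_mem_orientedEdges hm).1 h, rfl⟩
  · rintro ⟨i, hi, h⟩
    rw [← h]
    exact ⟨Or.inr ⟨i, hi, rfl⟩, rfl⟩

theorem ncard_orientedEdges_inter_cycleEdgesPos {m : ℕ} (hm : 3 ≤ m) (A B : Finset (Fin m)) :
    (orientedEdges A B ∩ cycleEdgesPos m).ncard = A.card := by
  rw [orientedEdges_inter_cycleEdgesPos hm,
    Set.ncard_image_of_injective _ fun i j h => (Prod.mk.inj h).1, Set.ncard_coe_finset]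

theorem ncard_orientedEdges_inter_cycleEdgesNeg {m : ℕ} (hm : 3 ≤ m) (A B : Finset (Fin m)) :
    (orientedEdges A B ∩ cycleEdgesNeg m).ncard = B.card := by
  rw [orientedEdges_inter_cycleEdgesNeg hm,
    Set.ncard_image_of_injective _ fun i j h => (Prod.mk.inj h).2, Set.ncard_coe_finset]

theorem ncard_orientedEdges {m : ℕ} (hm : 3 ≤ m) (A B : Finset (Fin m)) :
    (orientedEdges A B).ncard = A.card + B.card := by
  rw [← ncard_orientedEdges_inter_cycleEdgesPos hm A B,
    ← ncard_orientedEdges_inter_cycleEdgesNeg hm A B, orientedEdges_inter_cycleEdgesPos hm,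
    orientedEdges_inter_cycleEdgesNeg hm, ← Set.ncard_union_eq, orientedEdges]
  rw [Set.disjoint_left]
  rintro _ ⟨i, -, rfl⟩ ⟨j, -, h⟩
  obtain ⟨h1, h2⟩ := Prod.mk.inj h
  exact finRotate_finRotate_ne hm i (h2 ▸ h1)

theorem disjoint_orientedEdges_iff {m : ℕ} (hm : 3 ≤ m) (A B : Finset (Fin m)) :
    Disjoint (orientedEdges A B ∩ cycleEdgesPos m)
      (Prod.swap ⁻¹' (orientedEdges A B ∩ cycleEdgesNeg m)) ↔ Disjoint A B := by
  have hpre : Prod.swap ⁻¹' (orientedEdges A B ∩ cycleEdgesNeg m) =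
      (fun i => (i, finRotate m i)) '' (B : Set (Fin m)) := by
    rw [orientedEdges_inter_cycleEdgesNeg hm, ← Set.image_swap_eq_preimage_swap, Set.image_image]
    rfl
  rw [hpre, orientedEdges_inter_cycleEdgesPos hm,
    Set.disjoint_image_iff fun i j h => (Prod.mk.inj h).1, Finset.disjoint_coe]

theorem doubleEdges_cycleGraph {m : ℕ} (hm : 3 ≤ m) :
    doubleEdges (SimpleGraph.cycleGraph m) = orientedEdges Finset.univ Finset.univ := by
  obtain ⟨k, rfl⟩ : ∃ k, m = k + 2 := ⟨m - 2, by omega⟩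
  ext ⟨v, w⟩
  simp only [doubleEdges, orientedEdges, Set.mem_ofPred_eq, SimpleGraph.cycleGraph_adj,
    Set.mem_union, Set.mem_image, Finset.coe_univ, Set.mem_univ, true_and, Prod.mk.injEq,
    finRotate_apply, exists_eq_left, exists_eq_right, sub_eq_iff_eq_add]
  rw [or_comm, eq_comm, add_comm 1 v, eq_comm (a := v), add_comm 1 w]

/-- Reduces statements about arbitrary subquivers to pairs of index sets. -/
theorem exists_eq_orientedEdges {m : ℕ} (hm : 3 ≤ m) {R : Set (Fin m × Fin m)}
    (hR : R ⊆ doubleEdges (SimpleGraph.cycleGraph m)) :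
    ∃ A B : Finset (Fin m), R = orientedEdges A B := by
  classical
  rw [doubleEdges_cycleGraph hm] at hR
  refine ⟨Finset.univ.filter fun i => (i, finRotate m i) ∈ R,
    Finset.univ.filter fun i => (finRotate m i, i) ∈ R, ?_⟩
  ext e
  constructor
  · intro he
    rcases hR he with ⟨i, -, rfl⟩ | ⟨i, -, rfl⟩
    · exact Or.inl ⟨i, by simpa using he, rfl⟩
    · exact Or.inr ⟨i, by simpa using he, rfl⟩
  · rintro (⟨i, hi, rfl⟩ | ⟨i, hi, rfl⟩) <;> simpa using hi

theorem symmetricEdgePolytope_cycleGraph {m : ℕ} (hm : 3 ≤ m) :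
    symmetricEdgePolytope (SimpleGraph.cycleGraph m) =
      signedHull (cycleVector m) Finset.univ Finset.univ := by
  rw [symmetricEdgePolytope, doubleEdges_cycleGraph hm, directedEdgePolytope_orientedEdges]

theorem image_union_preimage_swap_cycleEdgesPos_diff {m : ℕ} (A : Finset (Fin m)) :
    (fun i => (i, finRotate m i)) '' (A : Set (Fin m)) ∪
        Prod.swap ⁻¹' (cycleEdgesPos m \ (fun i => (i, finRotate m i)) '' (A : Set (Fin m))) =
      orientedEdges A Aᶜ := by
  rw [orientedEdges]
  congr 1
  ext ⟨v, w⟩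
  simp only [Set.mem_preimage, Prod.swap_prod_mk, Set.mem_sdiff, cycleEdgesPos, Set.mem_ofPred_eq,
    Set.mem_image, Finset.mem_coe, Finset.mem_compl, Prod.mk.injEq]
  constructor
  · rintro ⟨rfl, h⟩
    exact ⟨w, fun hw => h ⟨w, hw, rfl, rfl⟩, rfl, rfl⟩
  · rintro ⟨i, hi, rfl, rfl⟩
    refine ⟨rfl, ?_⟩
    rintro ⟨j, hj, rfl, -⟩
    exact hi hj

theorem exists_eq_image_of_subset_cycleEdgesPos {m : ℕ} {E : Set (Fin m × Fin m)}
    (hE : E ⊆ cycleEdgesPos m) :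
    ∃ A : Finset (Fin m), E = (fun i => (i, finRotate m i)) '' (A : Set (Fin m)) := by
  classical
  refine ⟨Finset.univ.filter fun i => (i, finRotate m i) ∈ E, ?_⟩
  ext ⟨v, w⟩
  constructor
  · intro h
    obtain rfl : w = finRotate m v := hE h
    exact ⟨v, by simpa using h, rfl⟩
  · rintro ⟨i, hi, h⟩
    rw [← h]
    simpa using hi

/-! ### Facets and faces of the symmetric edge polytope -/

theorem isFacet_symmetricEdgePolytope_iff {n : ℕ} (hn : 2 ≤ n) (F : Set (Fin (2 * n) → ℝ)) :
    IsFacet (symmetricEdgePolytope (SimpleGraph.cycleGraph (2 * n))) F ↔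
      ∃ A : Finset (Fin (2 * n)), A.card = n ∧ F = signedHull (cycleVector (2 * n)) A Aᶜ := by
  have : Nonempty (Fin (2 * n)) := ⟨⟨0, by omega⟩⟩
  have hp := isLinearCircuit_cycleVector (2 * n)
  rw [IsFacet, symmetricEdgePolytope_cycleGraph (by omega), hp.polytopeDim_univ, Fintype.card_fin,
    ← hp.isFaceOfDim_facet_iff hn (Fintype.card_fin _)]
  constructor
  · rintro ⟨d, hd, h⟩
    obtain rfl : d = 2 * n - 2 := by omega
    exact hd
  · exact fun h => ⟨_, h, by omega⟩

theorem bijOn_facets {n : ℕ} (hn : 2 ≤ n) :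
    Set.BijOn
      (fun E : Set (Fin (2 * n) × Fin (2 * n)) =>
        directedEdgePolytope (E ∪ Prod.swap ⁻¹' (cycleEdgesPos (2 * n) \ E)))
      {E | E ⊆ cycleEdgesPos (2 * n) ∧ E.ncard = n}
      {F | IsFacet (symmetricEdgePolytope (SimpleGraph.cycleGraph (2 * n))) F} := by
  have hp := isLinearCircuit_cycleVector (2 * n)
  have hncard : ∀ A : Finset (Fin (2 * n)),
      ((fun i => (i, finRotate (2 * n) i)) '' (A : Set (Fin (2 * n)))).ncard = A.card := fun A => by
    rw [Set.ncard_image_of_injective _ fun i j h => (Prod.mk.inj h).1, Set.ncard_coe_finset]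
  refine ⟨?_, ?_, ?_⟩
  · rintro E ⟨hE, hEn⟩
    obtain ⟨A, rfl⟩ := exists_eq_image_of_subset_cycleEdgesPos hE
    rw [hncard] at hEn
    simp only [image_union_preimage_swap_cycleEdgesPos_diff, directedEdgePolytope_orientedEdges]
    exact (isFacet_symmetricEdgePolytope_iff hn _).2 ⟨A, hEn, rfl⟩
  · rintro E ⟨hE, -⟩ E' ⟨hE', -⟩ h
    obtain ⟨A, rfl⟩ := exists_eq_image_of_subset_cycleEdgesPos hE
    obtain ⟨A', rfl⟩ := exists_eq_image_of_subset_cycleEdgesPos hE'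
    simp only [image_union_preimage_swap_cycleEdgesPos_diff,
      directedEdgePolytope_orientedEdges] at h
    rw [(hp.signedHull_inj (by rw [Fintype.card_fin]; omega) h).1]
  · intro F hF
    obtain ⟨A, hA, rfl⟩ := (isFacet_symmetricEdgePolytope_iff hn _).1 hF
    refine ⟨(fun i => (i, finRotate (2 * n) i)) '' (A : Set (Fin (2 * n))), ⟨?_, ?_⟩, ?_⟩
    · rintro _ ⟨i, -, rfl⟩
      rfl
    · rw [hncard, hA]
    · simp only [image_union_preimage_swap_cycleEdgesPos_diff, directedEdgePolytope_orientedEdges]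

theorem mainTheorem5 (n : ℕ) (hn : 2 ≤ n) :
    polytopeDim (symmetricEdgePolytope (SimpleGraph.cycleGraph (2 * n))) = 2 * n - 1 ∧
    -- the subquivers that give facets
    (∀ R : Set (Fin (2 * n) × Fin (2 * n)),
      R ⊆ doubleEdges (SimpleGraph.cycleGraph (2 * n)) →
      (IsFacet (symmetricEdgePolytope (SimpleGraph.cycleGraph (2 * n)))
          (directedEdgePolytope R) ↔
        (R ∩ cycleEdgesPos (2 * n)).ncard = n ∧
        (R ∩ cycleEdgesNeg (2 * n)).ncard = n ∧
        Disjoint (R ∩ cycleEdgesPos (2 * n))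
          (Prod.swap ⁻¹' (R ∩ cycleEdgesNeg (2 * n))))) ∧
    -- the facets correspond to the `n`-element subsets of the set of `2 * n` positive edges
    Set.BijOn
      (fun E : Set (Fin (2 * n) × Fin (2 * n)) =>
        directedEdgePolytope (E ∪ Prod.swap ⁻¹' (cycleEdgesPos (2 * n) \ E)))
      {E | E ⊆ cycleEdgesPos (2 * n) ∧ E.ncard = n}
      {F | IsFacet (symmetricEdgePolytope (SimpleGraph.cycleGraph (2 * n))) F} ∧
    faceNumber (symmetricEdgePolytope (SimpleGraph.cycleGraph (2 * n))) (2 * n - 2) =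
      (2 * n).choose n ∧
    -- the faces that are not facets
    (∀ d : ℕ, d < 2 * n - 2 →
      (∀ F, IsFaceOfDim (symmetricEdgePolytope (SimpleGraph.cycleGraph (2 * n))) d F →
        IsSimplexOfDim d F) ∧
      (∀ R : Set (Fin (2 * n) × Fin (2 * n)),
        R ⊆ doubleEdges (SimpleGraph.cycleGraph (2 * n)) →
        (IsFaceOfDim (symmetricEdgePolytope (SimpleGraph.cycleGraph (2 * n))) d
            (directedEdgePolytope R) ↔
          R.ncard = d + 1 ∧
          (R ∩ cycleEdgesPos (2 * n)).ncard < n ∧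
          (R ∩ cycleEdgesNeg (2 * n)).ncard < n ∧
          Disjoint (R ∩ cycleEdgesPos (2 * n))
            (Prod.swap ⁻¹' (R ∩ cycleEdgesNeg (2 * n))))) ∧
      faceNumber (symmetricEdgePolytope (SimpleGraph.cycleGraph (2 * n))) d =
        ∑ i ∈ evenCycleIndex n d, (2 * n).choose i * (2 * n - i).choose (d + 1 - i) ∧
      faceNumber (symmetricEdgePolytope (SimpleGraph.cycleGraph (2 * n))) d =
        (2 * n).choose (d + 1) * ∑ i ∈ evenCycleIndex n d, (d + 1).choose i ∧
      (d + 1 < n →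
        ∑ i ∈ evenCycleIndex n d, (d + 1).choose i = 2 ^ (d + 1) ∧
        faceNumber (symmetricEdgePolytope (SimpleGraph.cycleGraph (2 * n))) d =
          (2 * n).choose (d + 1) * 2 ^ (d + 1))) := by
  have : Nonempty (Fin (2 * n)) := ⟨⟨0, by omega⟩⟩
  have hm : 3 ≤ 2 * n := by omega
  have hcard : Fintype.card (Fin (2 * n)) = 2 * n := Fintype.card_fin _
  have hp := isLinearCircuit_cycleVector (2 * n)
  have hP := symmetricEdgePolytope_cycleGraph hm
  refine ⟨?_, ?_, bijOn_facets hn, ?_, ?_⟩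
  · rw [hP, hp.polytopeDim_univ, hcard]
  · intro R hR
    obtain ⟨A, B, rfl⟩ := exists_eq_orientedEdges hm hR
    rw [isFacet_symmetricEdgePolytope_iff hn, directedEdgePolytope_orientedEdges,
      ncard_orientedEdges_inter_cycleEdgesPos hm, ncard_orientedEdges_inter_cycleEdgesNeg hm,
      disjoint_orientedEdges_iff hm]
    constructor
    · rintro ⟨A', hA', h⟩
      -- The given `R` need not come from the face description a priori; injectivity identifies its
      -- index sets with those of the description.
      obtain ⟨rfl, rfl⟩ := hp.signedHull_inj (by omega) h
      refine ⟨hA', ?_, disjoint_compl_right⟩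
      rw [Finset.card_compl, hcard]
      omega
    · rintro ⟨hA, hB, hAB⟩
      refine ⟨A, hA, ?_⟩
      -- Disjoint sets of size `n` among `2n` indices are complementary.
      rw [Finset.eq_of_subset_of_card_le (Finset.subset_compl_iff_disjoint_left.2 hAB)]
      rw [Finset.card_compl, hcard]
      omega
  · rw [hP, hp.faceNumber_facet hn hcard]
  · intro d hd
    rw [hP]
    have hsum := hp.faceNumber_eq_sum hn hcard hd
    have hprod := hsum.trans (sum_evenCycleIndex_choose_mul n d)
    refine ⟨fun F hF => hp.isSimplexOfDim_of_isFaceOfDim hn hcard hd hF, ?_, hsum, hprod,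
      fun hdn => ⟨sum_evenCycleIndex_choose hdn, by rw [hprod, sum_evenCycleIndex_choose hdn]⟩⟩
    intro R hR
    obtain ⟨A, B, rfl⟩ := exists_eq_orientedEdges hm hR
    rw [hp.isFaceOfDim_iff hn hcard hd, directedEdgePolytope_orientedEdges,
      ncard_orientedEdges hm, ncard_orientedEdges_inter_cycleEdgesPos hm,
      ncard_orientedEdges_inter_cycleEdgesNeg hm, disjoint_orientedEdges_iff hm]
    constructor
    · rintro ⟨A', B', hAB, hA, hB, hd, h⟩
      obtain ⟨rfl, rfl⟩ := hp.signedHull_inj (by omega) h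
      exact ⟨hd, hA, hB, hAB⟩
    · rintro ⟨hd, hA, hB, hAB⟩
      exact ⟨A, B, hAB, hA, hB, hd, rfl⟩
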